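/- **Setting.** All manifolds are described in local coordinates: an $m$-dimensional manifold is represented by an open set $U\subseteq\mathbb R^m$. For a map $\psi$ with Jacobian $J(x)=\partial_x\psi(x)$ write $\dot J(x,\dot x)$ for the derivative of $J$ at $x$ in direction $\dot x$. For a real square matrix, $A\succ 0$ means $u^\top A u>0$ for all $u\neq 0$ (symmetry is not required). A *geometric dynamical system* (GDS) on $U\subseteq\mathbb R^m$ consists of symmetric positive semidefinite matrices $G(x,\dot x)$ (metric, $C^1$) and $B(x,\dot x)$ (damping, continuous), a $C^1$ potential $\Phi(x)$ that is bounded below, and a motion policy $\ddot x=a(x,\dot x)$ with $$M a+\xi_G=-\nabla\Phi-B\dot x,\qquad M=G+\Xi_G,\quad \Xi_G=\tfrac12\sum_i\dot x_i\,\partial_{\dot x}g_i,\quad \xi_G=[\partial_x g_i\,\dot x]_{i=1}^m\,\dot x-\tfrac12\nabla_x(\dot x^\top G\dot x),$$ where $g_i$ is the $i$-th column of $G$. An *RMP-tree\** is a finite rooted tree; every node carries an open coordinate domain, and the edge from a node with coordinate $x$ to its $i$-th child carries a $C^2$ map $\psi_i$ from the domain of the node into that of the child, with Jacobian $J_i$,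 and a real $C^1$ weight function $w_i(x)$ (an auxiliary state on which the weights may depend is held fixed). All leaves are GDSs. At a leaf put $f=Ma$, $L=\tfrac12\dot x^\top G\dot x-\Phi$ and $V=\tfrac12\dot x^\top G\dot x+\Phi$. At an inner node, with the quantities of the $i$-th child evaluated at its state $(\psi_i(x),J_i\dot x)$, put $$f=\sum_i\Big(w_iJ_i^\top(f_i-M_i\dot J_i\dot x)+L_i\nabla w_i-(\dot x^\top\nabla w_i)J_i^\top G_iJ_i\dot x\Big),\quad M=\sum_i w_iJ_i^\top M_iJ_i,\quad G=\sum_i w_iJ_i^\top G_iJ_i,$$ $$L=\sum_i w_iL_i,\quad V=\sum_i w_iV_i,\quad B=\sum_i w_iJ_i^\top B_iJ_i,\quad \Phi=\sum_i w_i\Phi_i .$$ Let $\mathtt r$ be the root, with coordinate $q$ in the open set $U\subseteq\mathbb R^d$. The global policy is $\ddot q=M_{\mathtt r}(q,\dot q)^\dagger f_{\mathtt r}(q,\dot q)$, where $\dagger$ is the Moore–Penrose inverse. **Theorem.** Suppose $M_{\mathtt r}(q,\dot q)\succ0$ for all $q\in U$ and $\dot q\in\mathbb R^d$. 1. Along every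 trajectory $q(t)\in U$ of the global policy, $\frac{d}{dt}V_{\mathtt r}(q,\dot q)=-\dot q^\top B_{\mathtt r}(q,\dot q)\,\dot q$; if all weight functions are nonnegative, this is $\le 0$. 2. If further $G_{\mathtt r}\succ0$ and $B_{\mathtt r}\succ0$ at all states, then every trajectory on $[0,\infty)$ whose state $(q(t),\dot q(t))$ remains in a compact subset of $U\times\mathbb R^d$ converges forwardly to $$S=\{(q,\dot q): q\in U,\ \nabla\Phi_{\mathtt r}(q)=0,\ \dot q=0\},$$ i.e. for every open set $W\supseteq S$ one has $(q(t),\dot q(t))\in W$ for all sufficiently large $t$. -/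

import Mathlib

open Matrix Set Filter Topology

/-- Coordinate vectors of an `m`-dimensional manifold. -/
abbrev Coord (m : ℕ) : Type := Fin m → ℝ

/-- The gradient `∇ f (x)`, as the column vector of partial derivatives. -/
noncomputable def grad {m : ℕ} (f : Coord m → ℝ) (x : Coord m) : Coord m :=
  fun k => fderiv ℝ f x (Pi.single k 1)

/-- The Jacobian matrix `J(x) = ∂ₓ ψ`. -/
noncomputable def jac {m n : ℕ} (ψ : Coord m → Coord n) (x : Coord m) :
    Matrix (Fin n) (Fin m) ℝ :=
  Matrix.of fun i k => fderiv ℝ ψ x (Pi.single k 1) i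

/-- The time derivative `J̇(x, ẋ)` of the Jacobian along a motion through `x` with velocity `v`. -/
noncomputable def jacDot {m n : ℕ} (ψ : Coord m → Coord n) (x v : Coord m) :
    Matrix (Fin n) (Fin m) ℝ :=
  Matrix.of fun i k => fderiv ℝ (fun y => jac ψ y i k) x v

/-- `Ξ_G(x, ẋ) = ½ ∑ᵢ ẋᵢ ∂_ẋ gᵢ(x, ẋ)`, with `gᵢ` the `i`-th column of `G`. -/
noncomputable def curvXi {m : ℕ} (G : Coord m → Coord m → Matrix (Fin m) (Fin m) ℝ)
    (x v : Coord m) : Matrix (Fin m) (Fin m) ℝ :=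
  Matrix.of fun j k =>
    (1 / 2 : ℝ) * ∑ i, v i * fderiv ℝ (fun u => G x u j i) v (Pi.single k 1)

/-- The matrix `[∂ₓ gᵢ(x, ẋ) ẋ]ᵢ`, with `gᵢ` the `i`-th column of `G`. -/
noncomputable def metricDot {m : ℕ} (G : Coord m → Coord m → Matrix (Fin m) (Fin m) ℝ)
    (x v : Coord m) : Matrix (Fin m) (Fin m) ℝ :=
  Matrix.of fun j i => fderiv ℝ (fun y => G y v j i) x v

/-- `ξ_G(x, ẋ) = [∂ₓ gᵢ(x, ẋ) ẋ]ᵢ ẋ - ½ ∇ₓ (ẋᵀ G(x, ẋ) ẋ)`. -/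
noncomputable def curvForce {m : ℕ} (G : Coord m → Coord m → Matrix (Fin m) (Fin m) ℝ)
    (x v : Coord m) : Coord m :=
  metricDot G x v *ᵥ v - (1 / 2 : ℝ) • grad (fun y => v ⬝ᵥ (G y v *ᵥ v)) x

/-- `A ≻ 0` for a square real matrix, in the sense `uᵀ A u > 0` for all `u ≠ 0`. Symmetry is not
demanded, since the inertia `G + Ξ_G` of a GDS need not be symmetric. -/
def IsPosDef {m : ℕ} (A : Matrix (Fin m) (Fin m) ℝ) : Prop :=
  ∀ u : Coord m, u ≠ 0 → 0 < u ⬝ᵥ (A *ᵥ u)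

/-- The four Penrose equations: `X` is the Moore-Penrose inverse of `A`. -/
structure IsMoorePenrose {m : ℕ} (A X : Matrix (Fin m) (Fin m) ℝ) : Prop where
  mul_mul_left : A * X * A = A
  mul_mul_right : X * A * X = X
  symm_left : (A * X)ᵀ = A * X
  symm_right : (X * A)ᵀ = X * A

/-- The Moore-Penrose inverse `A†` (it exists and is unique for every real matrix). -/
noncomputable def pinv {m : ℕ} (A : Matrix (Fin m) (Fin m) ℝ) : Matrix (Fin m) (Fin m) ℝ :=
  Classical.epsilon (IsMoorePenrose A)

/-- The data of a leaf: coordinate domain, metric, damping, potential, and motion policy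
`ẍ = a(x, ẋ)`. -/
structure Leaf (m : ℕ) where
  dom : Set (Coord m)
  G : Coord m → Coord m → Matrix (Fin m) (Fin m) ℝ
  B : Coord m → Coord m → Matrix (Fin m) (Fin m) ℝ
  Φ : Coord m → ℝ
  a : Coord m → Coord m → Coord m

namespace Leaf

/-- The inertia `M = G + Ξ_G`. -/
noncomputable def M {m : ℕ} (ℓ : Leaf m) (x v : Coord m) : Matrix (Fin m) (Fin m) ℝ :=
  ℓ.G x v + curvXi ℓ.G x v

/-- The leaf is a geometric dynamical system: `G` and `B` are symmetric positive semidefinite, `Φ`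
is bounded below, everything is smooth enough for the equations to make sense, and the policy
satisfies `M(x,ẋ) a + ξ_G(x,ẋ) = -∇Φ(x) - B(x,ẋ) ẋ`. -/
structure IsGDS {m : ℕ} (ℓ : Leaf m) : Prop where
  isOpen_dom : IsOpen ℓ.dom
  contDiffOn_G : ∀ i j,
    ContDiffOn ℝ 1 (fun p : Coord m × Coord m => ℓ.G p.1 p.2 i j) (ℓ.dom ×ˢ univ)
  posSemidef_G : ∀ x ∈ ℓ.dom, ∀ v, (ℓ.G x v).PosSemidef
  continuousOn_B : ∀ i j,
    ContinuousOn (fun p : Coord m × Coord m => ℓ.B p.1 p.2 i j) (ℓ.dom ×ˢ univ)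
  posSemidef_B : ∀ x ∈ ℓ.dom, ∀ v, (ℓ.B x v).PosSemidef
  contDiffOn_Φ : ContDiffOn ℝ 1 ℓ.Φ ℓ.dom
  bddBelow_Φ : BddBelow (ℓ.Φ '' ℓ.dom)
  policy : ∀ x ∈ ℓ.dom, ∀ v,
    ℓ.M x v *ᵥ ℓ.a x v + curvForce ℓ.G x v = -grad ℓ.Φ x - ℓ.B x v *ᵥ v

end Leaf

/-- A weighted RMP-tree whose root has an `m`-dimensional coordinate: either a leaf, or a root with
coordinate domain `dom` and `K` child subtrees, the edge to the `i`-th child carrying the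
transformation `ψ i` and the weight function `w i` of the parent configuration. -/
inductive RMPTree : ℕ → Type
  | leaf {m : ℕ} (ℓ : Leaf m) : RMPTree m
  | node {m : ℕ} (dom : Set (Coord m)) (K : ℕ) (dim : Fin K → ℕ)
      (ψ : ∀ i : Fin K, Coord m → Coord (dim i)) (w : Fin K → Coord m → ℝ)
      (child : ∀ i : Fin K, RMPTree (dim i)) : RMPTree m

namespace RMPTree

/-- The coordinate domain of the root. -/
def dom {m : ℕ} : RMPTree m → Set (Coord m)
  | .leaf ℓ => ℓ.dom
  | .node dom _ _ _ _ _ => dom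

/-- All leaves are GDSs, and all edge maps and weights are smooth on (open) coordinate domains. -/
def HasGDSLeaves : {m : ℕ} → RMPTree m → Prop
  | _, .leaf ℓ => ℓ.IsGDS
  | _, .node dom _ _ ψ w child =>
      IsOpen dom ∧ ∀ i, ContDiffOn ℝ 2 (ψ i) dom ∧ MapsTo (ψ i) dom (child i).dom ∧
        ContDiffOn ℝ 1 (w i) dom ∧ (child i).HasGDSLeaves

/-- All weight functions are nonnegative. -/
def WeightsNonneg : {m : ℕ} → RMPTree m → Prop
  | _, .leaf _ => True
  | _, .node dom _ _ _ w child => ∀ i, (∀ x ∈ dom, 0 ≤ w i x) ∧ (child i).WeightsNonneg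

/-! The quantities stored at the root, computed from the children by the modified pullback. Each
is a function of the root state `(x, v)`; the state of the `i`-th child is its pushforward
`(ψᵢ(x), Jᵢ(x) v)`. -/

/-- Inertia: `M = G + Ξ_G` at a leaf, `M = ∑ᵢ wᵢ Jᵢᵀ Mᵢ Jᵢ` otherwise. -/
noncomputable def M : {m : ℕ} → RMPTree m → Coord m → Coord m → Matrix (Fin m) (Fin m) ℝ
  | _, .leaf ℓ, x, v => ℓ.M x v
  | _, .node _ _ _ ψ w child, x, v =>
      ∑ i, w i x • ((jac (ψ i) x)ᵀ * (child i).M (ψ i x) (jac (ψ i) x *ᵥ v) * jac (ψ i) x)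

/-- Metric: `G = ∑ᵢ wᵢ Jᵢᵀ Gᵢ Jᵢ`. -/
noncomputable def G : {m : ℕ} → RMPTree m → Coord m → Coord m → Matrix (Fin m) (Fin m) ℝ
  | _, .leaf ℓ, x, v => ℓ.G x v
  | _, .node _ _ _ ψ w child, x, v =>
      ∑ i, w i x • ((jac (ψ i) x)ᵀ * (child i).G (ψ i x) (jac (ψ i) x *ᵥ v) * jac (ψ i) x)

/-- The scalar `L`: `½ ẋᵀ G ẋ - Φ` at a leaf, `L = ∑ᵢ wᵢ Lᵢ` otherwise. -/
noncomputable def L : {m : ℕ} → RMPTree m → Coord m → Coord m → ℝ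
  | _, .leaf ℓ, x, v => (1 / 2 : ℝ) * (v ⬝ᵥ (ℓ.G x v *ᵥ v)) - ℓ.Φ x
  | _, .node _ _ _ ψ w child, x, v =>
      ∑ i, w i x * (child i).L (ψ i x) (jac (ψ i) x *ᵥ v)

/-- Force: `f = M a` at a leaf, `f = ∑ᵢ (wᵢ Jᵢᵀ (fᵢ - Mᵢ J̇ᵢ ẋ) + hᵢ)` otherwise, with
`hᵢ = Lᵢ ∇wᵢ - (ẋᵀ ∇wᵢ) Jᵢᵀ Gᵢ Jᵢ ẋ`. -/
noncomputable def f : {m : ℕ} → RMPTree m → Coord m → Coord m → Coord m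
  | _, .leaf ℓ, x, v => ℓ.M x v *ᵥ ℓ.a x v
  | _, .node _ _ _ ψ w child, x, v =>
      ∑ i, (w i x • ((jac (ψ i) x)ᵀ *ᵥ
              ((child i).f (ψ i x) (jac (ψ i) x *ᵥ v)
                - (child i).M (ψ i x) (jac (ψ i) x *ᵥ v) *ᵥ (jacDot (ψ i) x v *ᵥ v)))
            + ((child i).L (ψ i x) (jac (ψ i) x *ᵥ v) • grad (w i) x
                - (v ⬝ᵥ grad (w i) x) •
                  (((jac (ψ i) x)ᵀ * (child i).G (ψ i x) (jac (ψ i) x *ᵥ v) * jac (ψ i) x) *ᵥ v)))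

/-- Lyapunov function: `½ ẋᵀ G ẋ + Φ` at a leaf, `V = ∑ᵢ wᵢ Vᵢ` otherwise. -/
noncomputable def V : {m : ℕ} → RMPTree m → Coord m → Coord m → ℝ
  | _, .leaf ℓ, x, v => (1 / 2 : ℝ) * (v ⬝ᵥ (ℓ.G x v *ᵥ v)) + ℓ.Φ x
  | _, .node _ _ _ ψ w child, x, v =>
      ∑ i, w i x * (child i).V (ψ i x) (jac (ψ i) x *ᵥ v)

/-- Damping: `B = ∑ᵢ wᵢ Jᵢᵀ Bᵢ Jᵢ`. -/
noncomputable def B : {m : ℕ} → RMPTree m → Coord m → Coord m → Matrix (Fin m) (Fin m) ℝ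
  | _, .leaf ℓ, x, v => ℓ.B x v
  | _, .node _ _ _ ψ w child, x, v =>
      ∑ i, w i x • ((jac (ψ i) x)ᵀ * (child i).B (ψ i x) (jac (ψ i) x *ᵥ v) * jac (ψ i) x)

/-- Potential: `Φ = ∑ᵢ wᵢ Φᵢ`. -/
noncomputable def Φ : {m : ℕ} → RMPTree m → Coord m → ℝ
  | _, .leaf ℓ, x => ℓ.Φ x
  | _, .node _ _ _ ψ w child, x => ∑ i, w i x * (child i).Φ (ψ i x)

/-- The global motion policy, obtained by resolving the root: `a = M† f`. -/
noncomputable def policy {m : ℕ} (T : RMPTree m) (x v : Coord m) : Coord m :=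
  pinv (T.M x v) *ᵥ T.f x v

/-- `q`, with velocity `qd`, is a trajectory over the times in `I` of `q̈ = policy(q, q̇)`. -/
structure IsTrajectoryOn {m : ℕ} (T : RMPTree m) (q qd : ℝ → Coord m) (I : Set ℝ) : Prop where
  mem_dom : ∀ t ∈ I, q t ∈ T.dom
  hasDeriv_q : ∀ t ∈ I, HasDerivWithinAt q (qd t) I t
  hasDeriv_qd : ∀ t ∈ I, HasDerivWithinAt qd (T.policy (q t) (qd t)) I t

end RMPTree

/-! The core is the energy balance `HasGDSLeaves.fderiv_V`: for every acceleration $a$, the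
derivative of $V$ in direction $(v,a)$ is $v\cdot(Ma-f)-v\cdot Bv$. It is proved by induction on the
tree, and $a$ must be arbitrary: a parent acceleration $a$ induces $\dot J v+Ja$ in a child, which
need not be the child's own policy. Consequently no inner node has to be invertible. At a leaf the
balance is the identity $\frac{d}{dt}\frac12 v^\top Gv=v\cdot(Ma+\xi_G)$ (`IsGDS.fderiv_kinetic`)
combined with the equation of motion. At an inner node the only new term is the variation of the
weights; since $V_i+L_i=\dot x_i^\top G_i\dot x_i$ with $\dot x_i=J_iv$ (`V_add_L`), the correction
force $h_i=L_i\nabla w_i-(v\cdot\nabla w_i)J_i^\top G_iJ_iv$ satisfies $v\cdot h_i=-(v\cdot\nabla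
w_i)V_i$, exactly what cancels it. At the root $M\succ0$ gives $Ma=f$, hence $\dot V=-v\cdot Bv$.

Convergence uses Barbalat's lemma twice in place of an invariance principle. On a compact set $V$
decreases to a limit and its derivative is uniformly continuous, so $v\cdot Bv\to0$ and then
$v\to0$. Applied to each component of $v$, the lemma gives $\ddot q\to0$. By compactness the state
approaches the points with $v=0$ and zero policy; there $f=M\cdot0=0$, and `f_zero` identifies $f$
at rest with $-\nabla\Phi$. -/

/-! ### Coordinate derivatives as Fréchet derivatives. -/

theorem ContinuousLinearMap.sum_smul_apply_single {m : ℕ} {E : Type*} [NormedAddCommGroup E]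
    [NormedSpace ℝ E] (A : Coord m →L[ℝ] E) (v : Coord m) :
    ∑ k, v k • A (Pi.single k 1) = A v := by
  conv_rhs => rw [← Finset.univ_sum_single v]
  rw [map_sum]
  refine Finset.sum_congr rfl fun k _ => ?_
  rw [← map_smul, ← Pi.single_smul, smul_eq_mul, mul_one]

theorem dotProduct_grad {m : ℕ} (f : Coord m → ℝ) (x v : Coord m) :
    v ⬝ᵥ grad f x = fderiv ℝ f x v := by
  rw [← (fderiv ℝ f x).sum_smul_apply_single v]
  simp [dotProduct, grad]

theorem jac_mulVec {m n : ℕ} (ψ : Coord m → Coord n) (x v : Coord m) :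
    jac ψ x *ᵥ v = fderiv ℝ ψ x v := by
  rw [← (fderiv ℝ ψ x).sum_smul_apply_single v]
  ext i
  simp [mulVec, dotProduct, jac, mul_comm]

theorem jacDot_mulVec {m n : ℕ} {ψ : Coord m → Coord n} {x : Coord m}
    (h : DifferentiableAt ℝ (fderiv ℝ ψ) x) (v u : Coord m) :
    jacDot ψ x v *ᵥ u = fderiv ℝ (fderiv ℝ ψ) x v u := by
  rw [← (fderiv ℝ (fderiv ℝ ψ) x v).sum_smul_apply_single u]
  ext i
  -- Evaluation at a basis vector and projection to a component are linear, so they commute with the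
  -- outer derivative.
  have key : ∀ k, fderiv ℝ (fun y => fderiv ℝ ψ y (Pi.single k 1) i) x v
      = fderiv ℝ (fderiv ℝ ψ) x v (Pi.single k 1) i := fun k => by
    have h1 := h.hasFDerivAt.clm_apply (hasFDerivAt_const (Pi.single k (1 : ℝ) : Coord m) x)
    have h2 := (hasFDerivAt_pi'.1 h1 i).fderiv
    rw [h2]
    simp
  simp [mulVec, dotProduct, jacDot, jac, key, mul_comm]

/-! ### Continuity of matrix operations on a set. -/

section Continuity

variable {X : Type*} [TopologicalSpace X] {s : Set X} {l m n : ℕ}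

theorem ContinuousOn.matrix_mul' {A : X → Matrix (Fin l) (Fin m) ℝ}
    {B : X → Matrix (Fin m) (Fin n) ℝ} (hA : ContinuousOn A s) (hB : ContinuousOn B s) :
    ContinuousOn (fun p => A p * B p) s :=
  (continuous_fst.matrix_mul continuous_snd).comp_continuousOn (hA.prodMk hB)

theorem ContinuousOn.mulVec' {A : X → Matrix (Fin m) (Fin n) ℝ} {v : X → Fin n → ℝ}
    (hA : ContinuousOn A s) (hv : ContinuousOn v s) : ContinuousOn (fun p => A p *ᵥ v p) s :=
  (continuous_fst.matrix_mulVec continuous_snd).comp_continuousOn (hA.prodMk hv)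

theorem ContinuousOn.dotProduct' {u v : X → Fin n → ℝ}
    (hu : ContinuousOn u s) (hv : ContinuousOn v s) : ContinuousOn (fun p => u p ⬝ᵥ v p) s :=
  (continuous_fst.dotProduct continuous_snd).comp_continuousOn (hu.prodMk hv)

theorem ContinuousOn.transpose' {A : X → Matrix (Fin m) (Fin n) ℝ}
    (hA : ContinuousOn A s) : ContinuousOn (fun p => (A p)ᵀ) s :=
  continuous_id.matrix_transpose.comp_continuousOn hA

theorem continuousOn_matrix {A : X → Matrix (Fin m) (Fin n) ℝ}
    (h : ∀ i j, ContinuousOn (fun p => A p i j) s) : ContinuousOn A s :=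
  continuousOn_pi.2 fun i => continuousOn_pi.2 fun j => h i j

end Continuity

/-! ### Regularity of gradients, Jacobians and the pushforward of states. -/

section Smoothness

variable {m n : ℕ} {U : Set (Coord m)}

theorem continuousOn_grad {f : Coord m → ℝ} (hU : IsOpen U) (hf : ContDiffOn ℝ 1 f U) :
    ContinuousOn (grad f) U :=
  continuousOn_pi.2 fun _ =>
    (hf.continuousOn_fderiv_of_isOpen hU le_rfl).clm_apply continuousOn_const

theorem continuousOn_jac {ψ : Coord m → Coord n} (hU : IsOpen U) (hψ : ContDiffOn ℝ 2 ψ U) :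
    ContinuousOn (jac ψ) U :=
  continuousOn_matrix fun i k => continuousOn_pi.1
    ((hψ.continuousOn_fderiv_of_isOpen hU (by norm_num)).clm_apply continuousOn_const) i

theorem ContDiffOn.contDiffOn_fderiv {ψ : Coord m → Coord n} (hU : IsOpen U)
    (hψ : ContDiffOn ℝ 2 ψ U) : ContDiffOn ℝ 1 (fderiv ℝ ψ) U :=
  hψ.fderiv_of_isOpen hU (by norm_num)

theorem ContDiffOn.differentiableAt_fderiv {ψ : Coord m → Coord n} (hU : IsOpen U)
    (hψ : ContDiffOn ℝ 2 ψ U) {x : Coord m} (hx : x ∈ U) :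
    DifferentiableAt ℝ (fderiv ℝ ψ) x :=
  ((hψ.contDiffOn_fderiv hU).differentiableOn (by norm_num)).differentiableAt (hU.mem_nhds hx)

theorem continuousOn_jacDot_mulVec {ψ : Coord m → Coord n} (hU : IsOpen U)
    (hψ : ContDiffOn ℝ 2 ψ U) :
    ContinuousOn (fun p : Coord m × Coord m => jacDot ψ p.1 p.2 *ᵥ p.2) (U ×ˢ univ) := by
  have h1 : ContinuousOn (fderiv ℝ (fderiv ℝ ψ)) U :=
    (hψ.contDiffOn_fderiv hU).continuousOn_fderiv_of_isOpen hU le_rfl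
  have h2 : ContinuousOn (fun p : Coord m × Coord m => fderiv ℝ (fderiv ℝ ψ) p.1) (U ×ˢ univ) :=
    h1.comp continuousOn_fst fun p hp => hp.1
  exact ((h2.clm_apply continuousOn_snd).clm_apply continuousOn_snd).congr fun p hp =>
    jacDot_mulVec (hψ.differentiableAt_fderiv hU hp.1) _ _

/-- The pushforward of states `(x, v) ↦ (ψ x, J v)` is `C¹`. -/
theorem contDiffOn_pushforward {ψ : Coord m → Coord n} (hU : IsOpen U)
    (hψ : ContDiffOn ℝ 2 ψ U) :
    ContDiffOn ℝ 1 (fun p : Coord m × Coord m => (ψ p.1, jac ψ p.1 *ᵥ p.2)) (U ×ˢ univ) := by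
  simp only [jac_mulVec]
  have hm : MapsTo Prod.fst (U ×ˢ (univ : Set (Coord m))) U := fun p hp => hp.1
  exact ((hψ.of_le (by norm_num)).comp contDiffOn_fst hm).prodMk
    (((hψ.contDiffOn_fderiv hU).comp contDiffOn_fst hm).clm_apply contDiffOn_snd)

/-- The product rule for $J(x)v$ produces the child acceleration $\dot Jv+Ja$. Only directions
$(v,a)$ tangent to a second-order motion matter, so the derivative is otherwise left unspecified. -/
theorem hasFDerivAt_pushforward {ψ : Coord m → Coord n} (hU : IsOpen U)
    (hψ : ContDiffOn ℝ 2 ψ U) {x : Coord m} (hx : x ∈ U) (v : Coord m) :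
    ∃ A : Coord m × Coord m →L[ℝ] Coord n × Coord n,
      HasFDerivAt (fun p : Coord m × Coord m => (ψ p.1, jac ψ p.1 *ᵥ p.2)) A (x, v) ∧
      ∀ a, A (v, a) = (jac ψ x *ᵥ v, jacDot ψ x v *ᵥ v + jac ψ x *ᵥ a) := by
  have h1 : HasFDerivAt ψ (fderiv ℝ ψ x) x :=
    ((hψ.differentiableOn (by norm_num)).differentiableAt (hU.mem_nhds hx)).hasFDerivAt
  have h2 := (hψ.differentiableAt_fderiv hU hx).hasFDerivAt
  have hf : HasFDerivAt (Prod.fst : Coord m × Coord m → Coord m) (.fst ℝ _ _) (x, v) :=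
    hasFDerivAt_fst
  have hs : HasFDerivAt (Prod.snd : Coord m × Coord m → Coord m) (.snd ℝ _ _) (x, v) :=
    hasFDerivAt_snd
  have h3 := (h1.comp (x, v) hf).prodMk ((h2.comp (x, v) hf).clm_apply hs)
  simp only [jac_mulVec, jacDot_mulVec (hψ.differentiableAt_fderiv hU hx)]
  refine ⟨_, h3, fun a => ?_⟩
  simp [add_comm]

end Smoothness

/-! ### Leaves: continuity of inertia and force, and the kinetic energy identity. -/

namespace Leaf

variable {m : ℕ} {ℓ : Leaf m}

theorem IsGDS.differentiableAt_G (h : ℓ.IsGDS) {x : Coord m} (hx : x ∈ ℓ.dom) (v : Coord m)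
    (i j : Fin m) :
    DifferentiableAt ℝ (fun p : Coord m × Coord m => ℓ.G p.1 p.2 i j) (x, v) :=
  ((h.contDiffOn_G i j).differentiableOn (by norm_num)).differentiableAt
    ((h.isOpen_dom.prod isOpen_univ).mem_nhds ⟨hx, mem_univ _⟩)

/-- Writing a partial derivative as a restriction of the joint one makes it jointly continuous in
$(x,v)$ and lets the two partial derivatives be added. -/
theorem IsGDS.hasFDerivAt_G_left (h : ℓ.IsGDS) {x : Coord m} (hx : x ∈ ℓ.dom) (v : Coord m)
    (i j : Fin m) :
    HasFDerivAt (fun y => ℓ.G y v i j)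
      ((fderiv ℝ (fun p : Coord m × Coord m => ℓ.G p.1 p.2 i j) (x, v)).comp (.inl ℝ _ _)) x :=
  HasFDerivAt.comp (g := fun p : Coord m × Coord m => ℓ.G p.1 p.2 i j) (f := fun y => (y, v)) x
    (h.differentiableAt_G hx v i j).hasFDerivAt (hasFDerivAt_prodMk_left x v)

theorem IsGDS.hasFDerivAt_G_right (h : ℓ.IsGDS) {x : Coord m} (hx : x ∈ ℓ.dom) (v : Coord m)
    (i j : Fin m) :
    HasFDerivAt (fun u => ℓ.G x u i j)
      ((fderiv ℝ (fun p : Coord m × Coord m => ℓ.G p.1 p.2 i j) (x, v)).comp (.inr ℝ _ _)) v :=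
  HasFDerivAt.comp (g := fun p : Coord m × Coord m => ℓ.G p.1 p.2 i j) v
    (h.differentiableAt_G hx v i j).hasFDerivAt (hasFDerivAt_prodMk_right x v)

theorem IsGDS.continuousOn_fderiv_G (h : ℓ.IsGDS) (i j : Fin m) :
    ContinuousOn (fderiv ℝ (fun p : Coord m × Coord m => ℓ.G p.1 p.2 i j)) (ℓ.dom ×ˢ univ) :=
  (h.contDiffOn_G i j).continuousOn_fderiv_of_isOpen (h.isOpen_dom.prod isOpen_univ) le_rfl

theorem IsGDS.contDiffOn_quad (h : ℓ.IsGDS) :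
    ContDiffOn ℝ 1 (fun p : Coord m × Coord m => p.2 ⬝ᵥ (ℓ.G p.1 p.2 *ᵥ p.2))
      (ℓ.dom ×ˢ univ) := by
  have hv : ∀ i, ContDiffOn ℝ 1 (fun p : Coord m × Coord m => p.2 i) (ℓ.dom ×ˢ univ) := fun i =>
    contDiffOn_pi.1 contDiffOn_snd i
  simp only [dotProduct, mulVec]
  exact ContDiffOn.sum fun i _ => (hv i).mul
    (ContDiffOn.sum fun j _ => (h.contDiffOn_G i j).mul (hv j))

theorem IsGDS.continuousOn_M (h : ℓ.IsGDS) :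
    ContinuousOn (fun p : Coord m × Coord m => ℓ.M p.1 p.2) (ℓ.dom ×ˢ univ) := by
  refine continuousOn_matrix fun j k => ?_
  have hv : ∀ i, ContinuousOn (fun p : Coord m × Coord m => p.2 i) (ℓ.dom ×ˢ univ) := fun i =>
    continuousOn_pi.1 continuousOn_snd i
  simp only [Leaf.M, curvXi, Matrix.add_apply, Matrix.of_apply]
  refine (h.contDiffOn_G j k).continuousOn.add (continuousOn_const.mul
    (continuousOn_finsetSum _ fun i _ => (hv i).mul ?_))
  refine ((h.continuousOn_fderiv_G j i).clm_apply
    (continuousOn_const (c := ((0 : Coord m), (Pi.single k 1 : Coord m))))).congr fun p hp => ?_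
  rw [(h.hasFDerivAt_G_right hp.1 p.2 j i).fderiv]
  simp

/-- The derivative of `y ↦ vᵀ G(y, v) v`. -/
theorem IsGDS.hasFDerivAt_quad_left (h : ℓ.IsGDS) {x : Coord m} (hx : x ∈ ℓ.dom) (v : Coord m) :
    HasFDerivAt (fun y => v ⬝ᵥ (ℓ.G y v *ᵥ v))
      ((fderiv ℝ (fun p : Coord m × Coord m => p.2 ⬝ᵥ (ℓ.G p.1 p.2 *ᵥ p.2)) (x, v)).comp
        (.inl ℝ _ _)) x := by
  have h1 : DifferentiableAt ℝ (fun p : Coord m × Coord m => p.2 ⬝ᵥ (ℓ.G p.1 p.2 *ᵥ p.2))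
      (x, v) := (h.contDiffOn_quad.differentiableOn (by norm_num)).differentiableAt
    ((h.isOpen_dom.prod isOpen_univ).mem_nhds ⟨hx, mem_univ _⟩)
  exact HasFDerivAt.comp (g := fun p : Coord m × Coord m => p.2 ⬝ᵥ (ℓ.G p.1 p.2 *ᵥ p.2))
    (f := fun y => (y, v)) x h1.hasFDerivAt (hasFDerivAt_prodMk_left x v)

theorem IsGDS.continuousOn_curvForce (h : ℓ.IsGDS) :
    ContinuousOn (fun p : Coord m × Coord m => curvForce ℓ.G p.1 p.2) (ℓ.dom ×ˢ univ) := by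
  refine ContinuousOn.sub (ContinuousOn.mulVec' (continuousOn_matrix fun j i => ?_)
    continuousOn_snd) (continuousOn_const.fun_smul (continuousOn_pi.2 fun k => ?_))
  · refine ((h.continuousOn_fderiv_G j i).clm_apply
      (continuousOn_snd.prodMk (continuousOn_const (c := (0 : Coord m))))).congr fun p hp => ?_
    simp only [metricDot, Matrix.of_apply]
    rw [(h.hasFDerivAt_G_left hp.1 p.2 j i).fderiv]
    simp
  · refine ((h.contDiffOn_quad.continuousOn_fderiv_of_isOpen (h.isOpen_dom.prod isOpen_univ)
      le_rfl).clm_apply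
      (continuousOn_const (c := ((Pi.single k 1 : Coord m), (0 : Coord m))))).congr fun p hp => ?_
    simp only [grad]
    rw [(h.hasFDerivAt_quad_left hp.1 p.2).fderiv]
    simp

/-- The leaf force `f = M a`, expressed by the equation of motion. -/
theorem IsGDS.force_eq (h : ℓ.IsGDS) {x : Coord m} (hx : x ∈ ℓ.dom) (v : Coord m) :
    ℓ.M x v *ᵥ ℓ.a x v = -grad ℓ.Φ x - ℓ.B x v *ᵥ v - curvForce ℓ.G x v :=
  eq_sub_of_add_eq (h.policy x hx v)

/-- The policy `a` is not assumed continuous and the leaf inertia may be singular; the equation of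
motion nevertheless writes the product $Ma$ in continuous terms. -/
theorem IsGDS.continuousOn_force (h : ℓ.IsGDS) :
    ContinuousOn (fun p : Coord m × Coord m => ℓ.M p.1 p.2 *ᵥ ℓ.a p.1 p.2) (ℓ.dom ×ˢ univ) := by
  have h1 : ContinuousOn (fun p : Coord m × Coord m => grad ℓ.Φ p.1) (ℓ.dom ×ˢ univ) :=
    (continuousOn_grad h.isOpen_dom h.contDiffOn_Φ).comp continuousOn_fst fun p hp => hp.1
  exact ((h1.neg.sub ((continuousOn_matrix h.continuousOn_B).mulVec' continuousOn_snd)).sub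
    h.continuousOn_curvForce).congr fun p hp => h.force_eq hp.1 p.2

theorem curvForce_zero (G : Coord m → Coord m → Matrix (Fin m) (Fin m) ℝ) (x : Coord m) :
    curvForce G x 0 = 0 := by
  ext k
  simp [curvForce, grad]

/-- With the velocity argument of $G$ frozen, $v\cdot\nabla_x(v^\top Gv)$ is the quadratic form of
`metricDot`, so the second term of $\xi_G$ cancels half of the first. -/
theorem dotProduct_curvForce (h : ℓ.IsGDS) {x : Coord m} (hx : x ∈ ℓ.dom) (v : Coord m) :
    v ⬝ᵥ curvForce ℓ.G x v = (1 / 2 : ℝ) * (v ⬝ᵥ (metricDot ℓ.G x v *ᵥ v)) := by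
  have h1 : HasFDerivAt (fun y => ∑ i, v i * ∑ j, ℓ.G y v i j * v j) _ x :=
    HasFDerivAt.fun_sum fun i _ => (HasFDerivAt.fun_sum fun j _ =>
      (h.hasFDerivAt_G_left hx v i j).mul_const (v j)).const_mul (v i)
  have h2 : fderiv ℝ (fun y => v ⬝ᵥ (ℓ.G y v *ᵥ v)) x v = v ⬝ᵥ (metricDot ℓ.G x v *ᵥ v) := by
    have h3 := DFunLike.congr_fun h1.fderiv v
    refine h3.trans ?_
    simp only [metricDot, (h.hasFDerivAt_G_left hx v _ _).fderiv]
    simp [dotProduct, mulVec, mul_comm]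
  rw [curvForce, dotProduct_sub, dotProduct_smul, dotProduct_grad, h2, smul_eq_mul]
  ring

/-- The derivative of the kinetic energy `½ vᵀ G v` in a direction `(v, a)`. -/
theorem IsGDS.fderiv_kinetic (h : ℓ.IsGDS) {x : Coord m} (hx : x ∈ ℓ.dom) (v a : Coord m) :
    (1 / 2 : ℝ) *
      fderiv ℝ (fun p : Coord m × Coord m => p.2 ⬝ᵥ (ℓ.G p.1 p.2 *ᵥ p.2)) (x, v) (v, a)
      = v ⬝ᵥ (ℓ.M x v *ᵥ a + curvForce ℓ.G x v) := by
  have hv : ∀ i, HasFDerivAt (fun p : Coord m × Coord m => p.2 i)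
      ((ContinuousLinearMap.proj i).comp (.snd ℝ _ _)) (x, v) := fun i =>
    ((ContinuousLinearMap.proj (R := ℝ) (φ := fun _ : Fin m => ℝ) i).comp
      (.snd ℝ (Coord m) (Coord m))).hasFDerivAt
  have h1 : HasFDerivAt (fun p : Coord m × Coord m => ∑ i, p.2 i * ∑ j, ℓ.G p.1 p.2 i j * p.2 j) _
      (x, v) := HasFDerivAt.fun_sum fun i _ => (hv i).fun_mul (HasFDerivAt.fun_sum fun j _ =>
      (h.differentiableAt_G hx v i j).hasFDerivAt.fun_mul (hv j))
  -- Differentiating the outer factors $v$ gives $a\cdot Gv+v\cdot Ga$; symmetry makes this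
  -- $2\,v\cdot Ga$, which the factor $\frac12$ needs.
  have hsymm : ∀ i j, ℓ.G x v i j = ℓ.G x v j i := fun i j => by
    simpa using (h.posSemidef_G x hx v).isHermitian.apply j i
  have hsplit : ∀ i j, fderiv ℝ (fun p : Coord m × Coord m => ℓ.G p.1 p.2 i j) (x, v) (v, a)
      = fderiv ℝ (fun y => ℓ.G y v i j) x v + fderiv ℝ (fun u => ℓ.G x u i j) v a := fun i j => by
    rw [(h.hasFDerivAt_G_left hx v i j).fderiv, (h.hasFDerivAt_G_right hx v i j).fderiv]
    simp [← map_add]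
  -- $\Xi_G$ accounts for the dependence of $G$ on velocity: contracted with $a$, its partial
  -- derivatives form the directional derivative along $a$.
  have hXi : v ⬝ᵥ (curvXi ℓ.G x v *ᵥ a)
      = (1 / 2 : ℝ) * ∑ i, ∑ j, v i * (v j * fderiv ℝ (fun u => ℓ.G x u i j) v a) := by
    simp only [dotProduct, mulVec, curvXi, Matrix.of_apply, Finset.mul_sum,
      Finset.sum_mul]
    refine Finset.sum_congr rfl fun i _ => ?_
    rw [Finset.sum_comm]
    refine Finset.sum_congr rfl fun j _ => ?_
    rw [← (fderiv ℝ (fun u => ℓ.G x u i j) v).sum_smul_apply_single a]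
    simp only [Finset.mul_sum, smul_eq_mul]
    exact Finset.sum_congr rfl fun k _ => by ring
  have hG : v ⬝ᵥ (ℓ.G x v *ᵥ a) = (1 / 2 : ℝ) * ∑ i, ∑ j,
      (a i * (ℓ.G x v i j * v j) + v i * (ℓ.G x v i j * a j)) := by
    have e : ∑ i, ∑ j, a i * (ℓ.G x v i j * v j) = ∑ i, ∑ j, v i * (ℓ.G x v i j * a j) := by
      rw [Finset.sum_comm]
      exact Finset.sum_congr rfl fun i _ => Finset.sum_congr rfl fun j _ => by
        rw [hsymm j i]; ring
    have e' : v ⬝ᵥ (ℓ.G x v *ᵥ a) = ∑ i, ∑ j, v i * (ℓ.G x v i j * a j) := by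
      simp only [dotProduct, mulVec, Finset.mul_sum]
    simp only [Finset.sum_add_distrib, e, e']
    ring
  rw [dotProduct_add, dotProduct_curvForce h hx, Leaf.M, Matrix.add_mulVec, dotProduct_add, hXi,
    hG, ← mul_add, ← mul_add]
  congr 1
  refine (DFunLike.congr_fun h1.fderiv (v, a)).trans ?_
  simp only [dotProduct, mulVec, metricDot, Matrix.of_apply, Finset.mul_sum,
    ← Finset.sum_add_distrib]
  simp only [_root_.sum_apply, _root_.add_apply,
    _root_.smul_apply, ContinuousLinearMap.comp_apply, hsplit, smul_eq_mul,
    ContinuousLinearMap.proj_apply, ContinuousLinearMap.coe_snd', Finset.mul_sum, Finset.sum_mul,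
    ← Finset.sum_add_distrib]
  exact Finset.sum_congr rfl fun i _ => Finset.sum_congr rfl fun j _ => by ring

end Leaf

/-! ### Regularity of the tree quantities, by induction on the tree. -/

namespace RMPTree

theorem HasGDSLeaves.isOpen_dom {m : ℕ} {T : RMPTree m} (hT : T.HasGDSLeaves) :
    IsOpen T.dom := by
  cases T with
  | leaf ℓ => exact Leaf.IsGDS.isOpen_dom hT
  | node => exact hT.1

theorem mapsTo_pushforward {m n : ℕ} {U : Set (Coord m)} {U' : Set (Coord n)}
    {ψ : Coord m → Coord n} (h : MapsTo ψ U U') :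
    MapsTo (fun p : Coord m × Coord m => (ψ p.1, jac ψ p.1 *ᵥ p.2)) (U ×ˢ univ)
      (U' ×ˢ univ) :=
  fun _ hp => ⟨h hp.1, mem_univ _⟩

/-- A weighted sum of pullbacks `∑ᵢ wᵢ Jᵢᵀ Aᵢ Jᵢ` of continuous matrix fields is continuous. -/
theorem continuousOn_sum_pullback {m K : ℕ} {U : Set (Coord m)} {dim : Fin K → ℕ}
    {ψ : ∀ i : Fin K, Coord m → Coord (dim i)} {w : Fin K → Coord m → ℝ}
    {U' : ∀ i, Set (Coord (dim i))}
    {A : ∀ i, Coord (dim i) → Coord (dim i) → Matrix (Fin (dim i)) (Fin (dim i)) ℝ}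
    (hU : IsOpen U) (hψ : ∀ i, ContDiffOn ℝ 2 (ψ i) U) (hmaps : ∀ i, MapsTo (ψ i) U (U' i))
    (hw : ∀ i, ContDiffOn ℝ 1 (w i) U)
    (hA : ∀ i, ContinuousOn (fun p : Coord (dim i) × Coord (dim i) => A i p.1 p.2)
      (U' i ×ˢ univ)) :
    ContinuousOn (fun p : Coord m × Coord m => ∑ i, w i p.1 •
      ((jac (ψ i) p.1)ᵀ * A i (ψ i p.1) (jac (ψ i) p.1 *ᵥ p.2) * jac (ψ i) p.1))
      (U ×ˢ univ) := by
  have hm : MapsTo Prod.fst (U ×ˢ (univ : Set (Coord m))) U := fun p hp => hp.1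
  refine continuousOn_finsetSum _ fun i _ => ?_
  have hJ : ContinuousOn (fun p : Coord m × Coord m => jac (ψ i) p.1) (U ×ˢ univ) :=
    (continuousOn_jac hU (hψ i)).comp continuousOn_fst hm
  have hwi : ContinuousOn (fun p : Coord m × Coord m => w i p.1) (U ×ˢ univ) :=
    (hw i).continuousOn.comp continuousOn_fst hm
  exact hwi.fun_smul ((hJ.transpose'.matrix_mul' ((hA i).comp
    (contDiffOn_pushforward hU (hψ i)).continuousOn (mapsTo_pushforward (hmaps i)))).matrix_mul' hJ)

variable {m : ℕ} {T : RMPTree m}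

theorem HasGDSLeaves.continuousOn_M (hT : T.HasGDSLeaves) :
    ContinuousOn (fun p : Coord m × Coord m => T.M p.1 p.2) (T.dom ×ˢ univ) := by
  induction T with
  | leaf ℓ => exact Leaf.IsGDS.continuousOn_M hT
  | node U K dim ψ w child ih =>
    exact continuousOn_sum_pullback (A := fun i => (child i).M) hT.1 (fun i => (hT.2 i).1)
      (fun i => (hT.2 i).2.1) (fun i => (hT.2 i).2.2.1) fun i => ih i (hT.2 i).2.2.2

theorem HasGDSLeaves.continuousOn_G (hT : T.HasGDSLeaves) :
    ContinuousOn (fun p : Coord m × Coord m => T.G p.1 p.2) (T.dom ×ˢ univ) := by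
  induction T with
  | leaf ℓ =>
    exact continuousOn_matrix fun i j => (Leaf.IsGDS.contDiffOn_G hT i j).continuousOn
  | node U K dim ψ w child ih =>
    exact continuousOn_sum_pullback (A := fun i => (child i).G) hT.1 (fun i => (hT.2 i).1)
      (fun i => (hT.2 i).2.1) (fun i => (hT.2 i).2.2.1) fun i => ih i (hT.2 i).2.2.2

theorem HasGDSLeaves.continuousOn_B (hT : T.HasGDSLeaves) :
    ContinuousOn (fun p : Coord m × Coord m => T.B p.1 p.2) (T.dom ×ˢ univ) := by
  induction T with
  | leaf ℓ => exact continuousOn_matrix (Leaf.IsGDS.continuousOn_B hT)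
  | node U K dim ψ w child ih =>
    exact continuousOn_sum_pullback (A := fun i => (child i).B) hT.1 (fun i => (hT.2 i).1)
      (fun i => (hT.2 i).2.1) (fun i => (hT.2 i).2.2.1) fun i => ih i (hT.2 i).2.2.2

theorem HasGDSLeaves.contDiffOn_Φ (hT : T.HasGDSLeaves) : ContDiffOn ℝ 1 T.Φ T.dom := by
  induction T with
  | leaf ℓ => exact Leaf.IsGDS.contDiffOn_Φ hT
  | node U K dim ψ w child ih =>
    refine ContDiffOn.sum fun i _ => (hT.2 i).2.2.1.mul ?_
    exact (ih i (hT.2 i).2.2.2).comp ((hT.2 i).1.of_le (by norm_num)) (hT.2 i).2.1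

theorem HasGDSLeaves.contDiffOn_V (hT : T.HasGDSLeaves) :
    ContDiffOn ℝ 1 (fun p : Coord m × Coord m => T.V p.1 p.2) (T.dom ×ˢ univ) := by
  induction T with
  | leaf ℓ =>
    exact (contDiffOn_const.mul (Leaf.IsGDS.contDiffOn_quad hT)).add
      ((Leaf.IsGDS.contDiffOn_Φ hT).comp contDiffOn_fst fun p hp => hp.1)
  | node U K dim ψ w child ih =>
    refine ContDiffOn.sum fun i _ =>
      ((hT.2 i).2.2.1.comp contDiffOn_fst fun p hp => hp.1).mul ?_
    exact (ih i (hT.2 i).2.2.2).comp (contDiffOn_pushforward hT.1 (hT.2 i).1)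
      (mapsTo_pushforward (hT.2 i).2.1)

theorem HasGDSLeaves.hasFDerivAt_V (hT : T.HasGDSLeaves) {x : Coord m} (hx : x ∈ T.dom)
    (v : Coord m) :
    HasFDerivAt (fun p : Coord m × Coord m => T.V p.1 p.2)
      (fderiv ℝ (fun p : Coord m × Coord m => T.V p.1 p.2) (x, v)) (x, v) :=
  ((hT.contDiffOn_V.differentiableOn (by norm_num)).differentiableAt
    ((hT.isOpen_dom.prod isOpen_univ).mem_nhds ⟨hx, mem_univ _⟩)).hasFDerivAt

/-! ### Algebra of the pullback, the force at rest, and the energy balance. -/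

theorem quad_sum_pullback {m K : ℕ} {dim : Fin K → ℕ} (c : Fin K → ℝ)
    (J : ∀ i, Matrix (Fin (dim i)) (Fin m) ℝ)
    (A : ∀ i, Matrix (Fin (dim i)) (Fin (dim i)) ℝ) (u v : Coord m) :
    u ⬝ᵥ ((∑ i, c i • ((J i)ᵀ * A i * J i)) *ᵥ v)
      = ∑ i, c i * ((J i *ᵥ u) ⬝ᵥ (A i *ᵥ (J i *ᵥ v))) := by
  rw [Matrix.sum_mulVec, dotProduct_sum]
  refine Finset.sum_congr rfl fun i _ => ?_
  rw [Matrix.smul_mulVec, dotProduct_smul, smul_eq_mul, ← Matrix.mulVec_mulVec,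
    ← Matrix.mulVec_mulVec, Matrix.dotProduct_mulVec, Matrix.vecMul_transpose]

/-- `V + L` is twice the kinetic energy. -/
theorem V_add_L (T : RMPTree m) (x v : Coord m) :
    T.V x v + T.L x v = v ⬝ᵥ (T.G x v *ᵥ v) := by
  induction T with
  | leaf ℓ => simp only [V, L, G]; ring
  | node U K dim ψ w child ih =>
    simp only [V, L, G]
    rw [quad_sum_pullback, ← Finset.sum_add_distrib]
    exact Finset.sum_congr rfl fun i _ => by rw [← ih i, mul_add]

/-- By `V_add_L`, $L=v^\top Gv-V$, so no separate induction is needed. -/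
theorem HasGDSLeaves.continuousOn_L (hT : T.HasGDSLeaves) :
    ContinuousOn (fun p : Coord m × Coord m => T.L p.1 p.2) (T.dom ×ˢ univ) :=
  ((continuousOn_snd.dotProduct' (hT.continuousOn_G.mulVec' continuousOn_snd)).sub
    hT.contDiffOn_V.continuousOn).congr fun p _ => by
      simp only [Pi.sub_apply, ← T.V_add_L]; ring

theorem HasGDSLeaves.continuousOn_f (hT : T.HasGDSLeaves) :
    ContinuousOn (fun p : Coord m × Coord m => T.f p.1 p.2) (T.dom ×ˢ univ) := by
  induction T with
  | leaf ℓ => exact Leaf.IsGDS.continuousOn_force hT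
  | @node m U K dim ψ w child ih =>
    simp only [f]
    refine continuousOn_finsetSum _ fun i _ => ?_
    obtain ⟨hψ, hmaps, hw, hc⟩ := hT.2 i
    have hU : IsOpen U := hT.1
    have hm : MapsTo Prod.fst (U ×ˢ (univ : Set (Coord m))) U := fun p hp => hp.1
    have hJ : ContinuousOn (fun p : Coord m × Coord m => jac (ψ i) p.1) (U ×ˢ univ) :=
      (continuousOn_jac hU hψ).comp continuousOn_fst hm
    have hw0 : ContinuousOn (fun p : Coord m × Coord m => w i p.1) (U ×ˢ univ) :=
      hw.continuousOn.comp continuousOn_fst hm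
    have hw1 : ContinuousOn (fun p : Coord m × Coord m => grad (w i) p.1) (U ×ˢ univ) :=
      (continuousOn_grad hU hw).comp continuousOn_fst hm
    have hp := (contDiffOn_pushforward hU hψ).continuousOn
    have hpm := mapsTo_pushforward hmaps
    have hf := (ih i hc).comp hp hpm
    have hM := hc.continuousOn_M.comp hp hpm
    have hG := hc.continuousOn_G.comp hp hpm
    have hL := hc.continuousOn_L.comp hp hpm
    exact (hw0.fun_smul (hJ.transpose'.mulVec'
      (hf.fun_sub (hM.mulVec' (continuousOn_jacDot_mulVec hU hψ))))).fun_add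
      ((hL.fun_smul hw1).fun_sub ((continuousOn_snd.dotProduct' hw1).fun_smul
        (((hJ.transpose'.matrix_mul' hG).matrix_mul' hJ).mulVec' continuousOn_snd)))

theorem L_zero (T : RMPTree m) (x : Coord m) : T.L x 0 = -T.Φ x := by
  induction T with
  | leaf ℓ => simp [L, Φ]
  | node U K dim ψ w child ih => simp [L, Φ, ih]

/-- At rest the force is the negative gradient of the potential. -/
theorem HasGDSLeaves.f_zero (hT : T.HasGDSLeaves) {x : Coord m} (hx : x ∈ T.dom) :
    T.f x 0 = -grad T.Φ x := by
  induction T with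
  | leaf ℓ =>
    simp only [f]
    rw [Leaf.IsGDS.force_eq hT hx, Leaf.curvForce_zero]
    simp [Φ]
  | @node m U K dim ψ w child ih =>
    have hx : x ∈ U := hx
    have hU : IsOpen U := hT.1
    have hΦ : HasFDerivAt (fun y => ∑ i, w i y * (child i).Φ (ψ i y)) _ x :=
      HasFDerivAt.fun_sum fun i _ =>
        (((hT.2 i).2.2.1.differentiableOn (by norm_num)).differentiableAt
          (hU.mem_nhds hx)).hasFDerivAt.fun_mul
        (((((hT.2 i).2.2.2.contDiffOn_Φ.differentiableOn (by norm_num)).differentiableAt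
          ((hT.2 i).2.2.2.isOpen_dom.mem_nhds ((hT.2 i).2.1 hx))).hasFDerivAt).comp x
          (((hT.2 i).1.differentiableOn (by norm_num)).differentiableAt
          (hU.mem_nhds hx)).hasFDerivAt)
    ext k
    have h1 : grad (RMPTree.node U K dim ψ w child).Φ x k = _ :=
      DFunLike.congr_fun hΦ.fderiv (Pi.single k 1)
    rw [Pi.neg_apply, h1]
    simp only [f, mulVec_zero, zero_dotProduct, zero_smul, sub_zero, L_zero,
      fun i => ih i (hT.2 i).2.2.2 ((hT.2 i).2.1 hx)]
    simp only [_root_.sum_apply, Finset.sum_apply, ← Finset.sum_neg_distrib]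
    refine Finset.sum_congr rfl fun i _ => ?_
    have h2 : ((jac (ψ i) x)ᵀ *ᵥ grad (child i).Φ (ψ i x)) k
        = fderiv ℝ (child i).Φ (ψ i x) (fderiv ℝ (ψ i) x (Pi.single k 1)) := by
      rw [← dotProduct_grad]
      rfl
    simp only [mulVec_neg, Pi.add_apply, Pi.smul_apply, Pi.neg_apply, h2, grad, smul_eq_mul,
      _root_.add_apply, _root_.smul_apply, ContinuousLinearMap.comp_apply]
    ring

/-- The energy balance: the rate of change of `V` in the direction of any acceleration `a`. -/
theorem HasGDSLeaves.fderiv_V (hT : T.HasGDSLeaves) {x : Coord m} (hx : x ∈ T.dom)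
    (v a : Coord m) :
    fderiv ℝ (fun p : Coord m × Coord m => T.V p.1 p.2) (x, v) (v, a)
      = v ⬝ᵥ (T.M x v *ᵥ a - T.f x v) - v ⬝ᵥ (T.B x v *ᵥ v) := by
  induction T with
  | @leaf m ℓ =>
    have hℓ : ℓ.IsGDS := hT
    have hx : x ∈ ℓ.dom := hx
    have h1 : DifferentiableAt ℝ (fun p : Coord m × Coord m => p.2 ⬝ᵥ (ℓ.G p.1 p.2 *ᵥ p.2))
        (x, v) := (hℓ.contDiffOn_quad.differentiableOn (by norm_num)).differentiableAt
      ((hℓ.isOpen_dom.prod isOpen_univ).mem_nhds ⟨hx, mem_univ _⟩)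
    have h2 : HasFDerivAt ℓ.Φ (fderiv ℝ ℓ.Φ x) x :=
      ((hℓ.contDiffOn_Φ.differentiableOn (by norm_num)).differentiableAt
      (hℓ.isOpen_dom.mem_nhds hx)).hasFDerivAt
    have hf : HasFDerivAt (Prod.fst : Coord m × Coord m → Coord m) (.fst ℝ _ _) (x, v) :=
      hasFDerivAt_fst
    have h3 : HasFDerivAt (fun p : Coord m × Coord m => (RMPTree.leaf ℓ).V p.1 p.2) _ (x, v) :=
      (h1.hasFDerivAt.const_mul (1 / 2 : ℝ)).fun_add (h2.comp (x, v) hf)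
    rw [h3.fderiv]
    simp only [_root_.add_apply, _root_.smul_apply, ContinuousLinearMap.comp_apply,
      ContinuousLinearMap.coe_fst', smul_eq_mul, hℓ.fderiv_kinetic hx, ← dotProduct_grad, M, f, B,
      hℓ.force_eq hx, dotProduct_add, dotProduct_sub, dotProduct_neg]
    ring
  | @node m U K dim ψ w child ih =>
    have hx : x ∈ U := hx
    have hU : IsOpen U := hT.1
    choose A hA hA' using fun i => hasFDerivAt_pushforward hU (hT.2 i).1 hx v
    have hf : HasFDerivAt (Prod.fst : Coord m × Coord m → Coord m) (.fst ℝ _ _) (x, v) :=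
      hasFDerivAt_fst
    have hw : ∀ i, HasFDerivAt (w i) (fderiv ℝ (w i) x) x := fun i =>
      (((hT.2 i).2.2.1.differentiableOn (by norm_num)).differentiableAt
        (hU.mem_nhds hx)).hasFDerivAt
    have h3 : HasFDerivAt (fun p : Coord m × Coord m =>
        ∑ i, w i p.1 * (child i).V (ψ i p.1) (jac (ψ i) p.1 *ᵥ p.2)) _ (x, v) :=
      HasFDerivAt.fun_sum fun i _ => ((hw i).comp (x, v) hf).fun_mul
        (HasFDerivAt.comp (g := fun p : Coord (dim i) × Coord (dim i) => (child i).V p.1 p.2) (x, v)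
          ((hT.2 i).2.2.2.hasFDerivAt_V ((hT.2 i).2.1 hx) (jac (ψ i) x *ᵥ v)) (hA i))
    refine (DFunLike.congr_fun h3.fderiv (v, a)).trans ?_
    simp only [M, f, B]
    rw [dotProduct_sub, quad_sum_pullback, quad_sum_pullback, dotProduct_sum,
      ← Finset.sum_sub_distrib, ← Finset.sum_sub_distrib, _root_.sum_apply]
    refine Finset.sum_congr rfl fun i _ => ?_
    simp only [_root_.add_apply, _root_.smul_apply, ContinuousLinearMap.comp_apply,
      ContinuousLinearMap.coe_fst', smul_eq_mul, hA']
    -- The induction hypothesis is used at the child acceleration $\dot J_iv+J_ia$; the term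
    -- $-M_i\dot J_iv$ in the force absorbs its first part.
    rw [ih i (hT.2 i).2.2.2 ((hT.2 i).2.1 hx)]
    -- This turns the power of the weight force, $(v\cdot\nabla w_i)(L_i-\dot x_i^\top G_i\dot x_i)$
    -- with $\dot x_i=J_iv$, into $-(v\cdot\nabla w_i)V_i$, matching the product rule for $w_iV_i$.
    have hG : v ⬝ᵥ (((jac (ψ i) x)ᵀ * (child i).G (ψ i x) (jac (ψ i) x *ᵥ v) * jac (ψ i) x) *ᵥ v)
        = (child i).V (ψ i x) (jac (ψ i) x *ᵥ v) + (child i).L (ψ i x) (jac (ψ i) x *ᵥ v) := by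
      rw [V_add_L, ← Matrix.mulVec_mulVec, ← Matrix.mulVec_mulVec, Matrix.dotProduct_mulVec,
        Matrix.vecMul_transpose]
    rw [dotProduct_add, dotProduct_smul, Matrix.dotProduct_mulVec v, Matrix.vecMul_transpose,
      dotProduct_sub v, dotProduct_smul, dotProduct_smul, hG, dotProduct_grad, Matrix.mulVec_add]
    simp only [dotProduct_sub, dotProduct_add, smul_eq_mul]
    ring

theorem WeightsNonneg.quad_B_nonneg (hw : T.WeightsNonneg) (hT : T.HasGDSLeaves) {x : Coord m}
    (hx : x ∈ T.dom) (v : Coord m) : 0 ≤ v ⬝ᵥ (T.B x v *ᵥ v) := by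
  induction T with
  | leaf ℓ =>
    simpa [B] using (Leaf.IsGDS.posSemidef_B hT x hx v).dotProduct_mulVec_nonneg v
  | node U K dim ψ w child ih =>
    simp only [B]
    rw [quad_sum_pullback]
    exact Finset.sum_nonneg fun i _ => mul_nonneg ((hw i).1 x hx)
      (ih i (hw i).2 (hT.2 i).2.2.2 ((hT.2 i).2.1 hx) _)

end RMPTree

/-! ### Definite matrices are invertible, and resolution at the root is inversion. -/

section PosDef

variable {m : ℕ} {A : Matrix (Fin m) (Fin m) ℝ}

theorem IsPosDef.isUnit_det (hA : IsPosDef A) : IsUnit A.det := by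
  rw [isUnit_iff_ne_zero]
  intro h
  obtain ⟨u, hu, hu0⟩ := Matrix.exists_mulVec_eq_zero_iff.2 h
  have := hA u hu
  rw [hu0, dotProduct_zero] at this
  exact lt_irrefl _ this

/-- The Moore-Penrose inverse of an invertible matrix is its inverse. -/
theorem pinv_eq_inv (hA : IsUnit A.det) : pinv A = A⁻¹ := by
  have h1 : A * A⁻¹ = 1 := Matrix.mul_nonsing_inv A hA
  have h2 : A⁻¹ * A = 1 := Matrix.nonsing_inv_mul A hA
  have h : IsMoorePenrose A (pinv A) :=
    Classical.epsilon_spec ⟨A⁻¹, by simp [h1], by simp [h2], by simp [h1], by simp [h2]⟩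
  calc pinv A = A⁻¹ * (A * pinv A * A) * A⁻¹ := by
        rw [Matrix.mul_assoc A, ← Matrix.mul_assoc, h2, Matrix.one_mul, Matrix.mul_assoc, h1,
          Matrix.mul_one]
    _ = A⁻¹ := by rw [h.mul_mul_left, h2, Matrix.one_mul]

end PosDef

/-! ### Barbalat's lemma and convergence inside compact sets. -/

section Barbalat

/-- Barbalat's lemma: if `g` converges and its derivative is uniformly continuous, then the
derivative tends to `0`. -/
theorem tendsto_deriv_zero_of_uniformContinuousOn {g g' : ℝ → ℝ} {c : ℝ}
    (hg : ∀ t ∈ Ici (0 : ℝ), HasDerivWithinAt g (g' t) (Ici 0) t)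
    (hc : Tendsto g atTop (𝓝 c)) (hu : UniformContinuousOn g' (Ici 0)) :
    Tendsto g' atTop (𝓝 0) := by
  rw [Metric.tendsto_nhds]
  intro ε hε
  obtain ⟨δ, hδ, h⟩ := Metric.uniformContinuousOn_iff.1 hu (ε / 2) (half_pos hε)
  have hd : Tendsto (fun t => g (t + δ / 2) - g t) atTop (𝓝 0) := by
    have := (hc.comp (tendsto_atTop_add_const_right _ (δ / 2) tendsto_id)).sub hc
    simpa using this
  -- An increment below this bound over a time step $\delta/2$ has slope below $\varepsilon/2$; the
  -- mean value theorem realises that slope as a derivative within $\delta$ of $t$.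
  have hpos : 0 < ε / 2 * (δ / 2) := by positivity
  filter_upwards [Metric.tendsto_nhds.1 hd _ hpos, eventually_ge_atTop 0] with t ht ht0
  obtain ⟨s, hs, hs'⟩ := exists_hasDerivAt_eq_slope g g' (show t < t + δ / 2 by linarith)
    (fun s hs => (hg s (ht0.trans hs.1)).continuousWithinAt.mono
      fun r hr => ht0.trans hr.1)
    (fun s hs => (hg s (ht0.trans hs.1.le)).hasDerivAt (Ici_mem_nhds (ht0.trans_lt hs.1)))
  have h1 := h t ht0 s (ht0.trans hs.1.le) (by
    rw [Real.dist_eq, abs_lt]; constructor <;> linarith [hs.1, hs.2])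
  have h2 : |g' s| < ε / 2 := by
    rw [hs', add_sub_cancel_left, abs_div, abs_of_pos (half_pos hδ), div_lt_iff₀ (half_pos hδ)]
    simpa [Real.dist_eq] using ht
  rw [Real.dist_eq] at h1 ⊢
  rw [sub_zero]
  calc |g' t| = |(g' t - g' s) + g' s| := by ring_nf
    _ ≤ |g' t - g' s| + |g' s| := abs_add_le _ _
    _ < ε := by linarith

/-- A function with nonpositive derivative on `[0, ∞)` that is bounded below converges. -/
theorem exists_tendsto_of_hasDerivWithinAt_nonpos {g g' : ℝ → ℝ}
    (hg : ∀ t ∈ Ici (0 : ℝ), HasDerivWithinAt g (g' t) (Ici 0) t)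
    (hg' : ∀ t ∈ Ici (0 : ℝ), g' t ≤ 0) (hb : BddBelow (g '' Ici 0)) :
    ∃ c, Tendsto g atTop (𝓝 c) := by
  have hanti : AntitoneOn g (Ici 0) :=
    antitoneOn_of_hasDerivWithinAt_nonpos (convex_Ici 0)
      (fun t ht => (hg t ht).continuousWithinAt)
      (fun t ht => (hg t (interior_subset ht)).mono interior_subset)
      (fun t ht => hg' t (interior_subset ht))
  -- Freezing `g` at its initial value for negative times gives a globally antitone function, to
  -- which monotone convergence applies.
  have h1 : Antitone fun t => g (max t 0) := fun s t hst =>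
    hanti (mem_Ici.2 (le_max_right _ _)) (mem_Ici.2 (le_max_right _ _)) (max_le_max_right 0 hst)
  refine ⟨_, (tendsto_atTop_ciInf h1 (hb.mono ?_)).congr' ?_⟩
  · rintro _ ⟨t, rfl⟩
    exact ⟨_, mem_Ici.2 (le_max_right _ _), rfl⟩
  · filter_upwards [eventually_ge_atTop 0] with t ht
    rw [max_eq_left ht]

/-- A curve in a compact set along which a continuous function tends to `0` converges to every set
that contains the zeros of that function. -/
theorem tendsto_nhdsSet_of_isCompact {X E ι : Type*} [TopologicalSpace X]
    [NormedAddCommGroup E] {l : Filter ι} {z : ι → X} {F : X → E} {C S : Set X}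
    (hC : IsCompact C) (hF : ContinuousOn F C) (hz : ∀ᶠ t in l, z t ∈ C)
    (h0 : Tendsto (fun t => F (z t)) l (𝓝 0)) (hS : ∀ p ∈ C, F p = 0 → p ∈ S) :
    Tendsto z l (𝓝ˢ S) := by
  rw [(hasBasis_nhdsSet S).tendsto_right_iff]
  rintro W ⟨hW, hSW⟩
  rcases (C \ W).eq_empty_or_nonempty with h | h
  · filter_upwards [hz] with t ht
    exact sdiff_eq_empty.1 h ht
  -- On the compact set $C\setminus W$ the norm of $F$ has a positive minimum; once $\|F(z)\|$ is
  -- below it, the curve must be in $W$.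
  · obtain ⟨p, hp, hmin⟩ := (hC.diff hW).exists_isMinOn h (hF.mono sdiff_subset).norm
    have hpos : 0 < ‖F p‖ := norm_pos_iff.2 fun hFp => hp.2 (hSW (hS p hp.1 hFp))
    have h1 := h0.norm
    rw [norm_zero] at h1
    filter_upwards [hz, h1.eventually_lt_const hpos] with t ht hlt
    by_contra hn
    exact absurd (hmin ⟨ht, hn⟩) (not_le.2 hlt)

/-- Continuous functions of a curve that stays in a compact set and has a continuous velocity field
are uniformly continuous in time. -/
theorem uniformContinuousOn_comp_of_isCompact {E F : Type*} [NormedAddCommGroup E]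
    [NormedSpace ℝ E] [NormedAddCommGroup F] {z : ℝ → E} {Y : E → E} {C : Set E}
    {H : E → F} (hC : IsCompact C) (hY : ContinuousOn Y C) (hH : ContinuousOn H C)
    (hzC : ∀ t ∈ Ici (0 : ℝ), z t ∈ C)
    (hz : ∀ t ∈ Ici (0 : ℝ), HasDerivWithinAt z (Y (z t)) (Ici 0) t) :
    UniformContinuousOn (fun t => H (z t)) (Ici 0) := by
  -- A velocity bounded on the compact set makes the curve Lipschitz.
  obtain ⟨K, hK⟩ := hC.exists_bound_of_continuousOn hY
  have hlip : LipschitzOnWith K.toNNReal z (Ici 0) :=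
    (convex_Ici 0).lipschitzOnWith_of_nnnorm_hasDerivWithin_le hz fun t ht => by
      rw [← NNReal.coe_le_coe, coe_nnnorm]
      exact (hK _ (hzC t ht)).trans (Real.le_coe_toNNReal K)
  exact (hC.uniformContinuousOn_of_continuous hH).comp hlip.uniformContinuousOn hzC

end Barbalat

/-! ### Trajectories: energy decay and convergence. -/

namespace RMPTree

variable {m : ℕ} {T : RMPTree m}

theorem mulVec_policy {x v : Coord m} (h : IsPosDef (T.M x v)) :
    T.M x v *ᵥ T.policy x v = T.f x v := by
  rw [policy, pinv_eq_inv h.isUnit_det, Matrix.mulVec_mulVec,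
    Matrix.mul_nonsing_inv _ h.isUnit_det, Matrix.one_mulVec]

/-- The pseudoinverse is not continuous in general, but for invertible $M$ it is
$\det(M)^{-1}\operatorname{adj}M$. -/
theorem HasGDSLeaves.continuousOn_policy (hT : T.HasGDSLeaves)
    (hM : ∀ x ∈ T.dom, ∀ v, IsPosDef (T.M x v)) :
    ContinuousOn (fun p : Coord m × Coord m => T.policy p.1 p.2) (T.dom ×ˢ univ) := by
  have hdet : ContinuousOn (fun p : Coord m × Coord m => (T.M p.1 p.2).det) (T.dom ×ˢ univ) :=
    continuous_id.matrix_det.comp_continuousOn hT.continuousOn_M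
  have hadj : ContinuousOn (fun p : Coord m × Coord m => (T.M p.1 p.2).adjugate)
      (T.dom ×ˢ univ) := continuous_id.matrix_adjugate.comp_continuousOn hT.continuousOn_M
  refine (((hdet.inv₀ fun p hp => (hM p.1 hp.1 p.2).isUnit_det.ne_zero).fun_smul hadj).mulVec'
    hT.continuousOn_f).congr fun p hp => ?_
  rw [policy, pinv_eq_inv (hM p.1 hp.1 p.2).isUnit_det, Matrix.inv_def, Ring.inverse_eq_inv']
  rfl

theorem IsTrajectoryOn.hasDerivWithinAt_V {I : Set ℝ} {q qd : ℝ → Coord m}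
    (h : T.IsTrajectoryOn q qd I) (hT : T.HasGDSLeaves)
    (hM : ∀ x ∈ T.dom, ∀ v, IsPosDef (T.M x v)) {t : ℝ} (ht : t ∈ I) :
    HasDerivWithinAt (fun s => T.V (q s) (qd s))
      (-(qd t ⬝ᵥ (T.B (q t) (qd t) *ᵥ qd t))) I t := by
  have hq := h.mem_dom t ht
  have h1 := (hT.hasFDerivAt_V hq (qd t)).comp_hasDerivWithinAt t
    ((h.hasDeriv_q t ht).prodMk (h.hasDeriv_qd t ht))
  rwa [hT.fderiv_V hq, mulVec_policy (hM _ hq _), sub_self, dotProduct_zero, zero_sub] at h1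

theorem IsTrajectoryOn.hasDerivWithinAt_state {I : Set ℝ} {q qd : ℝ → Coord m}
    (h : T.IsTrajectoryOn q qd I) {t : ℝ} (ht : t ∈ I) :
    HasDerivWithinAt (fun t => (q t, qd t)) (qd t, T.policy (q t) (qd t)) I t :=
  (h.hasDeriv_q t ht).prodMk (h.hasDeriv_qd t ht)

/-- Continuous functions of the state are uniformly continuous in time along a trajectory that stays
in a compact set. -/
theorem IsTrajectoryOn.uniformContinuousOn_comp {q qd : ℝ → Coord m}
    (h : T.IsTrajectoryOn q qd (Ici 0)) (hT : T.HasGDSLeaves)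
    (hM : ∀ x ∈ T.dom, ∀ v, IsPosDef (T.M x v))
    {C : Set (Coord m × Coord m)} (hC : IsCompact C) (hCdom : C ⊆ T.dom ×ˢ univ)
    (hzC : ∀ t ∈ Ici (0 : ℝ), (q t, qd t) ∈ C) {H : Coord m → Coord m → ℝ}
    (hH : ContinuousOn (fun p : Coord m × Coord m => H p.1 p.2) C) :
    UniformContinuousOn (fun t => H (q t) (qd t)) (Ici 0) :=
  uniformContinuousOn_comp_of_isCompact (z := fun t => (q t, qd t))
    (Y := fun p : Coord m × Coord m => (p.2, T.policy p.1 p.2))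
    (H := fun p : Coord m × Coord m => H p.1 p.2) hC
    (continuousOn_snd.prodMk ((hT.continuousOn_policy hM).mono hCdom)) hH hzC
    fun _ ht => h.hasDerivWithinAt_state ht

theorem IsTrajectoryOn.tendsto_velocity {q qd : ℝ → Coord m}
    (h : T.IsTrajectoryOn q qd (Ici 0)) (hT : T.HasGDSLeaves)
    (hM : ∀ x ∈ T.dom, ∀ v, IsPosDef (T.M x v)) (hB : ∀ x ∈ T.dom, ∀ v, IsPosDef (T.B x v))
    {C : Set (Coord m × Coord m)} (hC : IsCompact C) (hCdom : C ⊆ T.dom ×ˢ univ)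
    (hzC : ∀ t ∈ Ici (0 : ℝ), (q t, qd t) ∈ C) :
    Tendsto qd atTop (𝓝 0) := by
  have hQ : ContinuousOn (fun p : Coord m × Coord m => -(p.2 ⬝ᵥ (T.B p.1 p.2 *ᵥ p.2))) C :=
    (continuousOn_snd.dotProduct'
      ((hT.continuousOn_B.mono hCdom).mulVec' continuousOn_snd)).fun_neg
  have hneg : ∀ p ∈ C, p.2 ≠ 0 → -(p.2 ⬝ᵥ (T.B p.1 p.2 *ᵥ p.2)) < 0 := fun p hp h0 =>
    neg_lt_zero.2 (hB p.1 (hCdom hp).1 p.2 p.2 h0)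
  have hnonpos : ∀ t ∈ Ici (0 : ℝ), -(qd t ⬝ᵥ (T.B (q t) (qd t) *ᵥ qd t)) ≤ 0 := fun t ht => by
    rcases eq_or_ne (qd t) 0 with h0 | h0
    · simp [h0]
    · exact (hneg _ (hzC t ht) h0).le
  have hV : ∀ t ∈ Ici (0 : ℝ), HasDerivWithinAt (fun s => T.V (q s) (qd s))
      (-(qd t ⬝ᵥ (T.B (q t) (qd t) *ᵥ qd t))) (Ici 0) t := fun t ht =>
    h.hasDerivWithinAt_V hT hM ht
  -- The lower bound comes from compactness: with weights of either sign, $V$ need not inherit the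
  -- lower bounds of the leaf potentials.
  have hbdd : BddBelow ((fun s => T.V (q s) (qd s)) '' Ici 0) := by
    refine (hC.bddBelow_image (hT.contDiffOn_V.continuousOn.mono hCdom)).mono ?_
    rintro _ ⟨t, ht, rfl⟩
    exact ⟨_, hzC t ht, rfl⟩
  obtain ⟨c, hc⟩ := exists_tendsto_of_hasDerivWithinAt_nonpos hV hnonpos hbdd
  have hQ0 := tendsto_deriv_zero_of_uniformContinuousOn hV hc
    (h.uniformContinuousOn_comp hT hM hC hCdom hzC
      (H := fun x v => -(v ⬝ᵥ (T.B x v *ᵥ v))) hQ)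
  -- Definiteness of $B$ makes $v=0$ the only zeros of the dissipation rate.
  have h1 : Tendsto (fun t => (q t, qd t)) atTop (𝓝ˢ {p : Coord m × Coord m | p.2 = 0}) :=
    tendsto_nhdsSet_of_isCompact hC hQ ((eventually_ge_atTop 0).mono hzC) hQ0
      fun p hp h0 => by_contra fun hne => (hneg p hp hne).ne h0
  have h2 : Tendsto Prod.snd (𝓝ˢ {p : Coord m × Coord m | p.2 = 0}) (𝓝ˢ {0}) :=
    continuous_snd.tendsto_nhdsSet fun p hp => hp
  rw [nhdsSet_singleton] at h2
  exact h2.comp h1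

theorem IsTrajectoryOn.tendsto_nhdsSet {q qd : ℝ → Coord m}
    (h : T.IsTrajectoryOn q qd (Ici 0)) (hT : T.HasGDSLeaves)
    (hM : ∀ x ∈ T.dom, ∀ v, IsPosDef (T.M x v)) (hB : ∀ x ∈ T.dom, ∀ v, IsPosDef (T.B x v))
    {C : Set (Coord m × Coord m)} (hC : IsCompact C) (hCdom : C ⊆ T.dom ×ˢ univ)
    (hzC : ∀ t ∈ Ici (0 : ℝ), (q t, qd t) ∈ C) :
    Tendsto (fun t => (q t, qd t)) atTop
      (𝓝ˢ {p : Coord m × Coord m | p.1 ∈ T.dom ∧ grad T.Φ p.1 = 0 ∧ p.2 = 0}) := by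
  have hP : ContinuousOn (fun p : Coord m × Coord m => T.policy p.1 p.2) C :=
    (hT.continuousOn_policy hM).mono hCdom
  have hqd := h.tendsto_velocity hT hM hB hC hCdom hzC
  -- Second use of Barbalat: each velocity component converges, and its derivative, the policy, is
  -- uniformly continuous in time.
  have hP0 : Tendsto (fun t => T.policy (q t) (qd t)) atTop (𝓝 0) := by
    rw [tendsto_pi_nhds]
    intro k
    exact tendsto_deriv_zero_of_uniformContinuousOn (g := fun t => qd t k)
      (g' := fun t => T.policy (q t) (qd t) k)
      (fun t ht => hasDerivWithinAt_pi.1 (h.hasDeriv_qd t ht) k) (tendsto_pi_nhds.1 hqd k)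
      (h.uniformContinuousOn_comp hT hM hC hCdom hzC (H := fun x v => T.policy x v k)
        (continuousOn_pi.1 hP k))
  refine tendsto_nhdsSet_of_isCompact
    (F := fun p : Coord m × Coord m => (p.2, T.policy p.1 p.2)) hC (continuousOn_snd.prodMk hP)
    ((eventually_ge_atTop 0).mono hzC) (hqd.prodMk_nhds hP0) fun p hp h0 => ?_
  obtain ⟨hv, hp0⟩ := Prod.mk.inj h0
  have hx := (hCdom hp).1
  refine ⟨hx, ?_, hv⟩
  have h1 := mulVec_policy (hM p.1 hx p.2)
  rw [hp0, mulVec_zero, hv, hT.f_zero hx] at h1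
  exact neg_eq_zero.1 h1.symm

end RMPTree

theorem theorem2 {d : ℕ} (T : RMPTree d) (hT : T.HasGDSLeaves)
    (hM : ∀ x ∈ T.dom, ∀ v, IsPosDef (T.M x v)) :
    (∀ (I : Set ℝ) (q qd : ℝ → Coord d), T.IsTrajectoryOn q qd I →
      (∀ t ∈ I, HasDerivWithinAt (fun s => T.V (q s) (qd s))
        (-(qd t ⬝ᵥ (T.B (q t) (qd t) *ᵥ qd t))) I t) ∧
      (T.WeightsNonneg → ∀ t ∈ I, -(qd t ⬝ᵥ (T.B (q t) (qd t) *ᵥ qd t)) ≤ 0)) ∧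
    ((∀ x ∈ T.dom, ∀ v, IsPosDef (T.G x v)) → (∀ x ∈ T.dom, ∀ v, IsPosDef (T.B x v)) →
      ∀ q qd : ℝ → Coord d, T.IsTrajectoryOn q qd (Ici 0) →
      ∀ C : Set (Coord d × Coord d), IsCompact C → C ⊆ T.dom ×ˢ univ →
        (∀ t ∈ Ici (0 : ℝ), (q t, qd t) ∈ C) →
        Tendsto (fun t => (q t, qd t)) atTop
          (𝓝ˢ {p : Coord d × Coord d | p.1 ∈ T.dom ∧ grad T.Φ p.1 = 0 ∧ p.2 = 0})) := by
  refine ⟨fun I q qd h => ⟨fun t ht => h.hasDerivWithinAt_V hT hM ht, fun hw t ht =>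
    neg_nonpos.2 (hw.quad_B_nonneg hT (h.mem_dom t ht) _)⟩, ?_⟩
  intro _ hB q qd h C hC hCdom hzC
  exact h.tendsto_nhdsSet hT hM hB hC hCdom hzC
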